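/- Let $\mathbb{F}_q$ be a finite field with $q$ elements, let $m\ge 1$ and let $w=(w_0,w_1,\dots,w_m)$ be integers with $1=w_0\le w_1\le\dots\le w_m$. Let $\mathbb{P}(w)=\mathbb{P}(1,w_1,\dots,w_m)$ be the weighted projective space, that is, the quotient of $\overline{\mathbb{F}_q}^{\,m+1}\setminus\{0\}$ by the action $\lambda\cdot(x_0,\dots,x_m)=(\lambda^{w_0}x_0,\dots,\lambda^{w_m}x_m)$ of $\overline{\mathbb{F}_q}^{\,*}$, and let $\mathbb{P}(w)(\mathbb{F}_q)$ be the set of its points that are fixed by the Frobenius map $(x_0:\dots:x_m)\mapsto(x_0^q:\dots:x_m^q)$. A polynomial in $\mathbb{F}_q[x_0,\dots,x_m]$ is weighted homogeneous of degree $d$ if each of its monomials $x_0^{a_0}\cdots x_m^{a_m}$ satisfies $w_0a_0+\dots+w_ma_m=d$. Put $p_k=\frac{q^{k+1}-1}{q-1}$ for $k\ge -1$ (so $p_{-1}=0$). Then for every integer $d\ge 1$, the maximum, over all nonzero weighted homogeneous polynomials $f\in\mathbb{F}_q[x_0,\dots,x_m]$ of degree $d$, of the number of points of $\mathbb{P}(w)(\mathbb{F}_q)$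 at which $f$ vanishes equals $$\min\left\{p_m,\ \left(\left\lfloor\frac{d-1}{w_1}\right\rfloor+1\right)q^{m-1}+p_{m-2}\right\}.$$ -/

import Mathlib

namespace WPS

/-- The action of scalars with weights `w`:
`λ · (x_i)_i = (λ ^ w_i * x_i)_i`. Two nonzero vectors are identified when they lie in the same
orbit of `Kˣ`. -/
def setoid (K : Type*) [Field K] {σ : Type*} (w : σ → ℕ) : Setoid {x : σ → K // x ≠ 0} where
  r x y := ∃ c : Kˣ, ∀ i, y.1 i = (c : K) ^ w i * x.1 i
  iseqv :=
    { refl := fun _ => ⟨1, fun _ => by simp⟩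
      symm := by
        rintro x y ⟨c, h⟩
        refine ⟨c⁻¹, fun i => ?_⟩
        rw [h i, ← mul_assoc, ← mul_pow]
        simp
      trans := by
        rintro x y z ⟨c, h⟩ ⟨e, h'⟩
        refine ⟨e * c, fun i => ?_⟩
        rw [h' i, h i, ← mul_assoc, ← mul_pow, Units.val_mul] }

/-- The points of the weighted projective space `ℙ(w)` with coordinates in the field `K`
(used with `K` algebraically closed): `(K ^ σ ∖ {0}) / Kˣ`. -/
def Points (K : Type*) [Field K] {σ : Type*} (w : σ → ℕ) : Type _ :=
  Quotient (setoid K w)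

/-- The point of `ℙ(w)` with weighted homogeneous coordinates `x`. -/
def mk {K : Type*} [Field K] {σ : Type*} (w : σ → ℕ) (x : {x : σ → K // x ≠ 0}) : Points K w :=
  Quotient.mk (setoid K w) x

/-- The `q`-power Frobenius `(x_i)_i ↦ (x_i ^ q)_i` on nonzero vectors. -/
def powVec {K : Type*} [Field K] {σ : Type*} (q : ℕ) (x : {x : σ → K // x ≠ 0}) :
    {x : σ → K // x ≠ 0} :=
  ⟨fun i => x.1 i ^ q, by
    obtain ⟨i, hi⟩ := Function.ne_iff.mp x.2
    exact Function.ne_iff.mpr ⟨i, pow_ne_zero q hi⟩⟩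

/-- The `q`-power Frobenius on the points of `ℙ(w)`. -/
def frob {K : Type*} [Field K] {σ : Type*} (w : σ → ℕ) (q : ℕ) : Points K w → Points K w :=
  Quotient.map (powVec q) (by
    rintro x y ⟨c, h⟩
    refine ⟨c ^ q, fun i => ?_⟩
    simp only [powVec, h i, mul_pow, Units.val_pow_eq_pow_val]
    rw [pow_right_comm])

/-- The `F`-rational points of `ℙ(w)`, for a finite field `F` with `q` elements: the points over
the algebraic closure of `F` that are fixed by the `q`-power Frobenius. -/
def rationalPoints (F : Type*) [Field F] {σ : Type*} (w : σ → ℕ) :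
    Set (Points (AlgebraicClosure F) w) :=
  {P | frob w (Nat.card F) P = P}

/-- The polynomial `f` vanishes at the point `P`: it vanishes at all the coordinate
vectors of `P`. -/
def Vanishes {F K : Type*} [Field F] [Field K] [Algebra F K] {σ : Type*} {w : σ → ℕ}
    (f : MvPolynomial σ F) (P : Points K w) : Prop :=
  ∀ x : {x : σ → K // x ≠ 0}, mk w x = P → MvPolynomial.aeval x.1 f = 0

/-- A weighted homogeneous polynomial of degree `d` satisfies `f (λ · x) = λ ^ d * f x`. -/
theorem aeval_smul {F K : Type*} [Field F] [Field K] [Algebra F K] {σ : Type*} {w : σ → ℕ}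
    {d : ℕ} {f : MvPolynomial σ F} (hf : f.IsWeightedHomogeneous w d) (c : K) (x : σ → K) :
    MvPolynomial.aeval (fun i => c ^ w i * x i) f = c ^ d * MvPolynomial.aeval x f := by
  rw [MvPolynomial.aeval_def, MvPolynomial.aeval_def, MvPolynomial.eval₂_eq,
    MvPolynomial.eval₂_eq, Finset.mul_sum]
  refine Finset.sum_congr rfl fun a ha => ?_
  have h := hf (MvPolynomial.mem_support_iff.mp ha)
  rw [Finsupp.weight_apply, Finsupp.sum] at h
  have h2 : ∏ i ∈ a.support, (c ^ w i * x i) ^ a i = c ^ d * ∏ i ∈ a.support, x i ^ a i := by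
    simp_rw [mul_pow, Finset.prod_mul_distrib, ← pow_mul, Finset.prod_pow_eq_pow_sum]
    rw [← h]
    simp only [smul_eq_mul, mul_comm]
  rw [h2]
  ring

/-- For a weighted homogeneous polynomial, vanishing at a point can be tested on any one
coordinate vector of that point. -/
theorem vanishes_mk_iff {F K : Type*} [Field F] [Field K] [Algebra F K] {σ : Type*} {w : σ → ℕ}
    {d : ℕ} {f : MvPolynomial σ F} (hf : f.IsWeightedHomogeneous w d)
    (x : {x : σ → K // x ≠ 0}) :
    Vanishes f (mk w x) ↔ MvPolynomial.aeval x.1 f = 0 := by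
  refine ⟨fun h => h x rfl, fun h y hy => ?_⟩
  obtain ⟨c, hc⟩ := Quotient.exact hy.symm
  rw [funext hc, aeval_smul hf, h, mul_zero]

/-- The set `V_{ℙ(w)}(f)(F)` of `F`-rational zeros of `f` on `ℙ(w)`. -/
def rationalZeros {F : Type*} [Field F] {σ : Type*} (w : σ → ℕ) (f : MvPolynomial σ F) :
    Set (Points (AlgebraicClosure F) w) :=
  {P | P ∈ rationalPoints F w ∧ Vanishes f P}

/-- The numbers of `F`-rational zeros on `ℙ(w)` of the nonzero weighted homogeneous polynomials
of degree `d` with coefficients in `F`. -/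
def zeroCounts (F : Type*) [Field F] {σ : Type*} (w : σ → ℕ) (d : ℕ) : Set ℕ∞ :=
  {N | ∃ f : MvPolynomial σ F,
    f ≠ 0 ∧ f.IsWeightedHomogeneous w d ∧ (rationalZeros w f).encard = N}

/-- `p_k = (q ^ (k + 1) - 1) / (q - 1)` for `k ≥ -1`; in particular `p_{-1} = 0`. -/
def p (q : ℕ) (k : ℤ) : ℕ :=
  (q ^ (k + 1).toNat - 1) / (q - 1)

/-- Nothing is lost in the truncated operations in the definition of `p`. -/
theorem p_cast {q : ℕ} (hq : 2 ≤ q) {k : ℤ} (hk : -1 ≤ k) :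
    (p q k : ℚ) = ((q : ℚ) ^ (k + 1) - 1) / ((q : ℚ) - 1) := by
  obtain ⟨n, hn⟩ := Int.eq_ofNat_of_zero_le (show 0 ≤ k + 1 by omega)
  have h1 : q - 1 ∣ q ^ n - 1 := by simpa using Nat.sub_dvd_pow_sub_pow q 1 n
  have h2 : ((q - 1 : ℕ) : ℚ) ≠ 0 := by
    rw [Nat.cast_ne_zero]
    omega
  unfold p
  rw [hn, Int.toNat_natCast, Nat.cast_div h1 h2, Nat.cast_sub (Nat.one_le_pow _ _ (by omega)),
    Nat.cast_sub (by omega)]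
  simp

end WPS

/-!
Counting on `ℙ(w)` reduces to counting vectors over `F`: by a Lang type argument, every rational
point has a coordinate vector in `F ^ (m + 1)`, and it has exactly `q - 1` of them, whatever its
stabilizer (`mem_rationalPoints_iff`, `card_fiber_ofVec`). With `c = w_1` and `k = ⌊(d - 1) / c⌋`,
the upper bound says that a nonzero `f` of degree `d` is nonzero at at least
`(q - 1) (q - k) q ^ (m - 1)` vectors (`le_card_eval_ne_zero`), and
`X_0 ^ (d - c |A|) ∏_{a ∈ A} (X_1 - a X_0 ^ c)`, with `A ⊆ F` of cardinality `min k q`, attains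
this bound (`card_eval_hyperplaneProduct_ne_zero`). For `k ≥ q` the bound is `0`.

The tool for the upper bound is a count along the lines with a fixed direction `v`
(`card_eval_ne_zero_alongLine`). Let `a` be the degree of `f (X + T v)` in `T`. On each line where
the leading coefficient, a polynomial in `X` of lower degree, does not vanish, at least `q - a`
points are not zeros, and the Schwartz–Zippel lemma bounds the number of these lines.

* If `c` does not divide `d`, the dehomogenization of `f` has degree at most `⌊d / c⌋ = k`, and
  Schwartz–Zippel on the chart `x_0 = 1` suffices (`card_chart_eval_ne_zero`).
* If `d = c e` and `f` involves a variable `X_i` of weight greater than `c`, take `v = e_i`. The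
  leading coefficient has weighted degree `d - a w_i < c (e - a)`, hence its dehomogenization has
  degree at most `e - 1 - a`, and `(q - a) (q - (e - 1 - a)) ≥ q (q - (e - 1))`. Again the chart
  `x_0 = 1` suffices.
* Otherwise `f = g (X_0 ^ c, X_1, …, X_m)` with a form `g` of degree `e`. The polynomials agree
  where `x_0` is `0` or `1`, so they have equally many zeros (`card_eval_ne_zero_eq`), and Serre's
  inequality for `g` (`serre_inequality`) is what is needed. For its proof take for `v` a zero of
  `g` with `1 ≤ a`; then `a ≤ e - 1`, and `(q - a) (q - (e - a)) ≥ (q - 1) (q - (e - 1))`. If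
  there is no such `v`, then `g` is invariant under translation by its zeros, and a line whose
  direction is not a zero contains at most one zero.
-/

namespace WPS

open MvPolynomial

/-! ### Restriction to parallel lines -/

section Lines

variable {R : Type*} [CommRing R] {σ : Type*}

/-- The polynomial `f (X + T v)` in the variable `T`, whose coefficients are polynomials in `X`:
the restriction of `f` to the lines with direction `v`. -/
noncomputable def alongLine (v : σ → R) :
    MvPolynomial σ R →ₐ[R] Polynomial (MvPolynomial σ R) :=
  aeval fun i => Polynomial.C (X i) + Polynomial.C (C (v i)) * Polynomial.X

theorem eval_alongLine (v : σ → R) (f : MvPolynomial σ R) (x : σ → R) (t : R) :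
    ((alongLine v f).map (eval x)).eval t = eval (x + t • v) f := by
  induction f using MvPolynomial.induction_on with
  | C a => simp [alongLine, Polynomial.algebraMap_apply, MvPolynomial.algebraMap_eq]
  | add p q hp hq => simp [hp, hq]
  | mul_X p i hp =>
    rw [map_mul, Polynomial.map_mul, Polynomial.eval_mul, hp, map_mul]
    simp [alongLine, mul_comm t]

theorem eval_zero_alongLine (v : σ → R) (f : MvPolynomial σ R) :
    (alongLine v f).eval 0 = f := by
  induction f using MvPolynomial.induction_on with
  | C a => simp [alongLine, Polynomial.algebraMap_apply, MvPolynomial.algebraMap_eq]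
  | add p q hp hq => simp [hp, hq]
  | mul_X p i hp => rw [map_mul, Polynomial.eval_mul, hp]; simp [alongLine]

theorem alongLine_ne_zero (v : σ → R) {f : MvPolynomial σ R} (hf : f ≠ 0) :
    alongLine v f ≠ 0 := fun h => hf (by rw [← eval_zero_alongLine v f, h, Polynomial.eval_zero])

theorem alongLine_eq_C (v : σ → R) {f : MvPolynomial σ R}
    (h : (alongLine v f).natDegree = 0) : alongLine v f = Polynomial.C f := by
  have h1 := Polynomial.eq_C_of_natDegree_eq_zero h
  rw [Polynomial.coeff_zero_eq_eval_zero, eval_zero_alongLine] at h1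
  exact h1

theorem notMem_vars_of_natDegree_alongLine_eq_zero [Nontrivial R] [DecidableEq σ] {i : σ}
    {f : MvPolynomial σ R} (h : (alongLine (Pi.single i 1) f).natDegree = 0) : i ∉ f.vars := by
  classical
  have h1 := alongLine_eq_C _ h
  -- Send `X i ↦ 0`, `T ↦ X i` in `f (X + T e_i)`.
  let s : σ → MvPolynomial σ R := fun j => if j = i then 0 else X j
  have key : ∀ p : MvPolynomial σ R,
      (alongLine (Pi.single i 1) p).eval₂ (bind₁ s : _ →ₐ[R] MvPolynomial σ R).toRingHom (X i)
        = p := by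
    intro p
    induction p using MvPolynomial.induction_on with
    | C a => simp [alongLine, Polynomial.algebraMap_apply, MvPolynomial.algebraMap_eq]
    | add p q hp hq => rw [map_add, Polynomial.eval₂_add, hp, hq]
    | mul_X p j hp =>
      rw [map_mul, Polynomial.eval₂_mul, hp]
      congr 1
      by_cases hj : j = i
      · subst hj
        simp [alongLine, s]
      · simp [alongLine, s, hj]
  have h2 := key f
  rw [h1, Polynomial.eval₂_C] at h2
  intro hi
  rw [← h2] at hi
  obtain ⟨j, -, hj⟩ := Finset.mem_biUnion.mp (vars_bind₁ s f hi)
  by_cases hji : j = i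
  · simp [s, hji] at hj
  · simp only [s, hji, if_false, vars_X, Finset.mem_singleton] at hj
    exact hji hj.symm

/-- If `v` is supported on coordinates of weight `t` and `T` gets the weight `t`, then
`f (X + T v)` is weighted homogeneous of the same degree as `f`. -/
theorem weight_of_coeff_alongLine_ne_zero {w : σ → ℕ} {v : σ → R} {t : ℕ}
    (hv : ∀ i, v i ≠ 0 → w i = t) {f : MvPolynomial σ R} {d : ℕ}
    (hf : f.IsWeightedHomogeneous w d) {j : ℕ} {b : σ →₀ ℕ}
    (hb : coeff b ((alongLine v f).coeff j) ≠ 0) : Finsupp.weight w b + j * t = d := by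
  classical
  -- The set of polynomials in `T` that are homogeneous of degree `n` in this sense.
  let P : ℕ → Polynomial (MvPolynomial σ R) → Prop := fun n p =>
    ∀ j b, coeff b (p.coeff j) ≠ 0 → Finsupp.weight w b + j * t = n
  have hmul : ∀ {n n' p p'}, P n p → P n' p' → P (n + n') (p * p') := by
    intro n n' p p' hp hp' j b hb
    rw [Polynomial.coeff_mul, coeff_sum] at hb
    obtain ⟨⟨j₁, j₂⟩, hj, hb⟩ := Finset.exists_ne_zero_of_sum_ne_zero hb
    rw [coeff_mul] at hb
    obtain ⟨⟨b₁, b₂⟩, hbb, hb⟩ := Finset.exists_ne_zero_of_sum_ne_zero hb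
    rw [Finset.HasAntidiagonal.mem_antidiagonal] at hj hbb
    have h1 := hp _ _ (left_ne_zero_of_mul hb)
    have h2 := hp' _ _ (right_ne_zero_of_mul hb)
    simp only at hj hbb h1 h2
    rw [← hj, ← hbb, map_add, ← h1, ← h2]
    ring
  have hone : P 0 1 := by
    intro j b hb
    rw [Polynomial.coeff_one] at hb
    split_ifs at hb with h
    · rw [coeff_one] at hb
      split_ifs at hb with h'
      · simp [← h', h]
      · exact absurd rfl hb
    · simp at hb
  have hX : ∀ i, P (w i) (Polynomial.C (X i) + Polynomial.C (C (v i)) * Polynomial.X) := by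
    intro i j b hb
    rw [Polynomial.coeff_add, Polynomial.coeff_C, Polynomial.coeff_C_mul, Polynomial.coeff_X]
      at hb
    rcases eq_or_ne j 0 with rfl | hj
    · simp only [if_true, one_ne_zero, if_false, mul_zero, add_zero, coeff_X] at hb
      split_ifs at hb with h
      · simp [← h, Finsupp.weight_single]
      · exact absurd rfl hb
    · rcases eq_or_ne j 1 with rfl | hj1
      · simp only [one_ne_zero, if_false, if_true, mul_one, zero_add, coeff_C] at hb
        split_ifs at hb with h
        · simp [← h, hv i hb]
        · exact absurd rfl hb
      · simp [hj, hj1.symm] at hb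
  have hpow : ∀ {n p} (k : ℕ), P n p → P (k * n) (p ^ k) := by
    intro n p k hp
    induction k with
    | zero => simpa using hone
    | succ k ih => rw [pow_succ, add_mul, one_mul]; exact hmul ih hp
  have hprod : ∀ (s : Finset σ) (b : σ →₀ ℕ), P (∑ i ∈ s, b i * w i)
      (∏ i ∈ s, (Polynomial.C (X i) + Polynomial.C (C (v i)) * Polynomial.X) ^ b i) := by
    intro s b
    induction s using Finset.induction_on with
    | empty => simpa using hone
    | insert a s ha ih =>
      rw [Finset.sum_insert ha, Finset.prod_insert ha]
      exact hmul (hpow _ (hX a)) ih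
  have hP : P d (alongLine v f) := by
    intro j b hb
    rw [alongLine, aeval_def, eval₂_eq, Polynomial.finsetSum_coeff, coeff_sum] at hb
    obtain ⟨a, ha, hb⟩ := Finset.exists_ne_zero_of_sum_ne_zero hb
    rw [Polynomial.algebraMap_apply, Polynomial.coeff_C_mul, MvPolynomial.algebraMap_eq,
      coeff_C_mul] at hb
    rw [hprod _ a j b (right_ne_zero_of_mul hb), ← hf (mem_support_iff.mp ha),
      Finsupp.weight_apply, Finsupp.sum]
    rfl
  exact hP j b hb

theorem natDegree_alongLine_mul_le {w : σ → ℕ} {v : σ → R} {t : ℕ}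
    (hv : ∀ i, v i ≠ 0 → w i = t) {f : MvPolynomial σ R} {d : ℕ}
    (hf : f.IsWeightedHomogeneous w d) (h0 : f ≠ 0) : (alongLine v f).natDegree * t ≤ d := by
  obtain ⟨b, hb⟩ := ne_zero_iff.mp
    (Polynomial.leadingCoeff_ne_zero.mpr (alongLine_ne_zero v h0))
  have := weight_of_coeff_alongLine_ne_zero hv hf hb
  omega

theorem isWeightedHomogeneous_leadingCoeff_alongLine {w : σ → ℕ} {v : σ → R} {t : ℕ}
    (hv : ∀ i, v i ≠ 0 → w i = t) {f : MvPolynomial σ R} {d : ℕ}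
    (hf : f.IsWeightedHomogeneous w d) :
    (alongLine v f).leadingCoeff.IsWeightedHomogeneous w
      (d - (alongLine v f).natDegree * t) := by
  intro b hb
  have := weight_of_coeff_alongLine_ne_zero hv hf hb
  omega

/-- Each line with direction `v` on which the leading coefficient of `f` along `v` does not
vanish contains at least `q - deg` points at which `f` does not vanish. -/
theorem card_eval_ne_zero_alongLine {F : Type*} [Field F] [Fintype F] [DecidableEq F]
    (v : σ → F) (f : MvPolynomial σ F) (S : Finset (σ → F))
    (hS : ∀ x ∈ S, ∀ t : F, x + t • v ∈ S) :
    (Fintype.card F - (alongLine v f).natDegree) *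
        (S.filter fun x => eval x (alongLine v f).leadingCoeff ≠ 0).card ≤
      Fintype.card F * (S.filter fun x => eval x f ≠ 0).card := by
  have h1 : ∀ t : F, (S.filter fun x => eval x f ≠ 0).card =
      (S.filter fun x => eval (x + t • v) f ≠ 0).card := by
    intro t
    refine (Finset.card_bij (fun x _ => x + t • v) ?_ ?_ ?_).symm
    · intro x hx
      rw [Finset.mem_filter] at hx ⊢
      exact ⟨hS x hx.1 t, hx.2⟩
    · intro x _ y _ h
      exact add_right_cancel h
    · intro y hy
      rw [Finset.mem_filter] at hy
      have : y + (-t) • v + t • v = y := by simp [add_assoc]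
      exact ⟨y + (-t) • v, Finset.mem_filter.mpr ⟨hS y hy.1 _, by rw [this]; exact hy.2⟩, this⟩
  have h2 : Fintype.card F * (S.filter fun x => eval x f ≠ 0).card =
      ∑ x ∈ S, (Finset.univ.filter fun t : F => eval (x + t • v) f ≠ 0).card := by
    rw [← Finset.card_univ, ← smul_eq_mul, ← Finset.sum_const, Finset.sum_congr rfl fun t _ => h1 t]
    simp_rw [Finset.card_filter]
    exact Finset.sum_comm
  rw [h2, mul_comm, ← smul_eq_mul, ← Finset.sum_const]
  refine (Finset.sum_le_sum fun x hx => ?_).trans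
    (Finset.sum_le_sum_of_subset (Finset.filter_subset _ S))
  have hx := (Finset.mem_filter.mp hx).2
  set g := (alongLine v f).map (eval x) with hg
  have hg0 : g ≠ 0 := by
    intro h
    apply hx
    have := congrArg (fun p => p.coeff (alongLine v f).natDegree) h
    simpa [hg, Polynomial.coeff_map] using this
  have h3 : (Finset.univ.filter fun t : F => ¬ eval (x + t • v) f ≠ 0).card ≤
      (alongLine v f).natDegree := by
    calc _ ≤ g.roots.toFinset.card := Finset.card_le_card fun t ht => by
            rw [Finset.mem_filter, not_not, ← eval_alongLine] at ht
            simpa [hg0] using ht.2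
      _ ≤ g.roots.card := g.roots.toFinset_card_le
      _ ≤ g.natDegree := g.card_roots'
      _ ≤ _ := Polynomial.natDegree_map_le
  have h4 := Finset.card_filter_add_card_filter_not (s := (Finset.univ : Finset F))
    (fun t : F => eval (x + t • v) f ≠ 0)
  rw [Finset.card_univ] at h4
  omega

end Lines

/-! ### Serre's inequality and dehomogenization -/

section Counting

variable {F : Type*} [Field F]

/-- The Schwartz–Zippel lemma, as a lower bound for the number of points of `F ^ n` at which `f`
does not vanish. -/
theorem card_eval_ne_zero_of_totalDegree_le [Fintype F] [DecidableEq F] {n D : ℕ}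
    {f : MvPolynomial (Fin n) F} (hf : f ≠ 0) (hD : f.totalDegree ≤ D) :
    (Fintype.card F - D) * Fintype.card F ^ n ≤
      Fintype.card F * (Finset.univ.filter fun x : Fin n → F => eval x f ≠ 0).card := by
  have h1 := schwartz_zippel_totalDegree hf (Finset.univ : Finset F)
  rw [Fintype.piFinset_univ, Finset.card_univ] at h1
  have hq : 0 < Fintype.card F := Fintype.card_pos
  rw [div_le_div_iff₀ (by positivity) (by positivity)] at h1
  have h2 : (Finset.univ.filter fun x : Fin n → F => eval x f = 0).card * Fintype.card F ≤
      D * Fintype.card F ^ n :=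
    le_trans (by exact_mod_cast h1) (Nat.mul_le_mul_right _ hD)
  have h3 := Finset.card_filter_add_card_filter_not (s := (Finset.univ : Finset (Fin n → F)))
    (fun x => eval x f = 0)
  rw [Finset.card_univ, Fintype.card_fun, Fintype.card_fin] at h3
  rw [tsub_mul, tsub_le_iff_left]
  nth_rw 1 [← h3]
  rw [mul_add, mul_comm _ (Finset.card _)]
  exact Nat.add_le_add_right h2 _

theorem eval_weighted_smul {σ : Type*} {w : σ → ℕ} {d : ℕ} {f : MvPolynomial σ F}
    (hf : f.IsWeightedHomogeneous w d) (c : F) (x : σ → F) :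
    eval (fun i => c ^ w i * x i) f = c ^ d * eval x f :=
  aeval_smul (K := F) hf c x

theorem eval_smul_of_isHomogeneous {σ : Type*} {d : ℕ} {f : MvPolynomial σ F}
    (hf : f.IsHomogeneous d) (c : F) (x : σ → F) :
    eval (c • x) f = c ^ d * eval x f := by
  rw [← eval_weighted_smul hf c x]
  congr 2
  ext i
  simp

/-- Along lines whose direction `v` is a zero of the form `g`, the degree of `g` drops: the
coefficient of `T ^ e` in `g (X + T v)` is `g v`. -/
theorem natDegree_alongLine_lt_of_eval_eq_zero {σ : Type*} {e : ℕ}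
    {g : MvPolynomial σ F} (hg : g.IsHomogeneous e) (h0 : g ≠ 0) {v : σ → F}
    (hv : eval v g = 0) : (alongLine v g).natDegree < e := by
  have hw : ∀ i, v i ≠ 0 → (1 : σ → ℕ) i = 1 := fun _ _ => rfl
  have hle := natDegree_alongLine_mul_le hw hg h0
  rw [mul_one] at hle
  refine lt_of_le_of_ne hle fun hdeg => ?_
  have hlc := Polynomial.leadingCoeff_ne_zero.mpr (alongLine_ne_zero v h0)
  obtain ⟨b, hb⟩ := ne_zero_iff.mp hlc
  have h1 := weight_of_coeff_alongLine_ne_zero hw hg hb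
  have hb0 : b = 0 := by
    have : b.degree = 0 := by
      rw [Finsupp.degree_eq_weight_one]
      change Finsupp.weight (1 : σ → ℕ) b = 0
      omega
    exact (Finsupp.degree_eq_zero_iff b).mp this
  -- At `X = 0` the restriction `g (T v)` is a multiple of `T ^ e`, and it vanishes at `T = 1`.
  have h2 : (alongLine v g).map (eval 0) =
      Polynomial.C (coeff 0 ((alongLine v g).coeff e)) * Polynomial.X ^ e := by
    ext j
    rw [Polynomial.coeff_map, Polynomial.coeff_C_mul, Polynomial.coeff_X_pow, ← constantCoeff_eq]
    split_ifs with hj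
    · rw [hj, mul_one, eval_zero]
    · rw [mul_zero, eval_zero, constantCoeff_eq]
      by_contra hne
      have := weight_of_coeff_alongLine_ne_zero hw hg hne
      rw [map_zero] at this
      omega
  have h3 := eval_alongLine v g 0 1
  rw [h2, one_smul, zero_add, hv] at h3
  simp only [Polynomial.eval_mul, Polynomial.eval_C, Polynomial.eval_pow, Polynomial.eval_X,
    one_pow, mul_one] at h3
  rw [Polynomial.leadingCoeff, hdeg, hb0] at hb
  exact hb h3

theorem sub_mul_sub_le {q a b k : ℕ} (h : a + b ≤ k) : q * (q - k) ≤ (q - a) * (q - b) := by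
  rcases le_total q k with hk | hk
  · simp [Nat.sub_eq_zero_of_le hk]
  · obtain ⟨r, rfl⟩ := Nat.exists_eq_add_of_le hk
    obtain ⟨s, rfl⟩ := Nat.exists_eq_add_of_le h
    rw [Nat.add_sub_cancel_left, show a + b + s + r - a = b + s + r by omega,
      show a + b + s + r - b = a + s + r by omega]
    nlinarith [Nat.zero_le (a * b), Nat.zero_le (a * s), Nat.zero_le (b * s), Nat.zero_le (s * s),
      Nat.zero_le (s * r)]

/-- **Serre's inequality**, as a lower bound for the number of vectors at which a form of degree
`e` does not vanish. The factor `q ^ 2` is kept on the right so that no exponent `n - 2` appears,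
and the bound is trivial for `e > q`, where the difference is truncated. -/
theorem serre_inequality [Fintype F] [DecidableEq F] {n e : ℕ} (he : 1 ≤ e)
    {g : MvPolynomial (Fin n) F} (hg : g.IsHomogeneous e) (h0 : g ≠ 0) :
    (Fintype.card F - 1) * (Fintype.card F + 1 - e) * Fintype.card F ^ n ≤
      Fintype.card F ^ 2 *
        (Finset.univ.filter fun x : Fin n → F => eval x g ≠ 0).card := by
  set q := Fintype.card F with hq
  have hw : ∀ v : Fin n → F, ∀ i, v i ≠ 0 → (1 : Fin n → ℕ) i = 1 := fun _ _ _ => rfl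
  by_cases hz : ∃ v, eval v g = 0 ∧ (alongLine v g).natDegree ≠ 0
  · -- Count along the lines in the direction of a zero `v`.
    obtain ⟨v, hv, hne⟩ := hz
    have hlt := natDegree_alongLine_lt_of_eval_eq_zero hg h0 hv
    have h1 := card_eval_ne_zero_alongLine v g Finset.univ (fun _ _ _ => Finset.mem_univ _)
    have h2 := card_eval_ne_zero_of_totalDegree_le
      (Polynomial.leadingCoeff_ne_zero.mpr (alongLine_ne_zero v h0))
      (IsHomogeneous.totalDegree_le (isWeightedHomogeneous_leadingCoeff_alongLine (hw v) hg))
    rw [mul_one] at h2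
    set a := (alongLine v g).natDegree
    have h3 : (q - 1) * (q + 1 - e) ≤ (q - a) * (q - (e - a)) := by
      have := sub_mul_sub_le (q := q - 1) (a := a - 1) (b := e - a - 1) (k := e - 2) (by omega)
      rwa [show q - 1 - (e - 2) = q + 1 - e by omega, show q - 1 - (a - 1) = q - a by omega,
        show q - 1 - (e - a - 1) = q - (e - a) by omega] at this
    calc _ ≤ (q - a) * (q - (e - a)) * q ^ n := Nat.mul_le_mul_right _ h3
      _ = (q - a) * ((q - (e - a)) * q ^ n) := mul_assoc _ _ _
      _ ≤ (q - a) * (q * _) := Nat.mul_le_mul_left _ h2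
      _ = q * ((q - a) * _) := by ring
      _ ≤ q * (q * _) := Nat.mul_le_mul_left _ h1
      _ = _ := by ring
  · -- Otherwise `g` is invariant under translations by its zeros.
    push Not at hz
    have hinv : ∀ v, eval v g = 0 → ∀ x, eval (x + v) g = eval x g := by
      intro v hv x
      have h1 := eval_alongLine v g x 1
      rw [alongLine_eq_C v (hz v hv)] at h1
      simpa using h1.symm
    obtain ⟨u, hu⟩ : ∃ u, eval u g ≠ 0 := by
      by_contra! hall
      obtain ⟨b, hb⟩ := ne_zero_iff.mp h0
      have hb0 : b = 0 := by
        ext i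
        by_contra hi
        exact notMem_vars_of_natDegree_alongLine_eq_zero (hz _ (hall (Pi.single i 1)))
          ((mem_vars_iff_mem_support i).mpr ⟨b, mem_support_iff.mpr hb,
            Finsupp.mem_support_iff.mpr hi⟩)
      have := hg hb
      rw [hb0, map_zero] at this
      omega
    -- Each line with direction `u` contains at most one zero.
    have hinj : q * (Finset.univ.filter fun x : Fin n → F => eval x g = 0).card ≤ q ^ n := by
      have : q ^ n = (Finset.univ : Finset (Fin n → F)).card := by
        rw [Finset.card_univ, Fintype.card_fun, Fintype.card_fin]
      rw [this, hq, ← Finset.card_univ, ← Finset.card_product]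
      refine Finset.card_le_card_of_injOn (fun p => p.2 + p.1 • u)
        (fun _ _ => Finset.mem_coe.mpr (Finset.mem_univ _)) ?_
      rintro ⟨t, z⟩ hz1 ⟨t', z'⟩ hz2 heq
      simp only [Finset.coe_product, Set.mem_prod, Finset.mem_coe, Finset.mem_filter,
        Finset.mem_univ, true_and] at hz1 hz2 heq
      have h1 : z = (t' - t) • u + z' := by
        rw [sub_smul, sub_add_eq_add_sub, eq_sub_iff_add_eq, heq, add_comm]
      have h2 : (t' - t) ^ e * eval u g = 0 := by
        rw [← eval_smul_of_isHomogeneous hg, ← hinv z' hz2, ← h1, hz1]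
      have h3 : t' - t = 0 := by
        rcases mul_eq_zero.mp h2 with h | h
        · exact eq_zero_of_pow_eq_zero h
        · exact absurd h hu
      rw [h3, zero_smul, zero_add] at h1
      rw [h1, sub_eq_zero.mp h3]
    have h3 := Finset.card_filter_add_card_filter_not (s := (Finset.univ : Finset (Fin n → F)))
      (fun x => eval x g = 0)
    rw [Finset.card_univ, Fintype.card_fun, Fintype.card_fin, ← hq] at h3
    have h4 : (q - 1) * q ^ n ≤
        q * (Finset.univ.filter fun x : Fin n → F => eval x g ≠ 0).card := by
      rw [tsub_mul, one_mul, tsub_le_iff_left]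
      calc q * q ^ n = q * (_ + _) := by rw [h3]
        _ = q * _ + q * _ := mul_add _ _ _
        _ ≤ _ := Nat.add_le_add_right hinj _
    calc (q - 1) * (q + 1 - e) * q ^ n ≤ (q - 1) * q * q ^ n := by gcongr; omega
      _ = q * ((q - 1) * q ^ n) := by ring
      _ ≤ q * (q * _) := Nat.mul_le_mul_left _ h4
      _ = _ := by ring

end Counting

section Dehomogenization

/-- The polynomial `f (1, X_1, …, X_m)`. -/
noncomputable def dehomogenize {R : Type*} [CommRing R] {m : ℕ} :
    MvPolynomial (Fin (m + 1)) R →ₐ[R] MvPolynomial (Fin m) R :=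
  aeval (Fin.cons 1 X : Fin (m + 1) → MvPolynomial (Fin m) R)

theorem eval_dehomogenize {R : Type*} [CommRing R] {m : ℕ} (f : MvPolynomial (Fin (m + 1)) R)
    (x : Fin m → R) :
    eval x (dehomogenize f) = eval (Fin.cons 1 x : Fin (m + 1) → R) f := by
  induction f using MvPolynomial.induction_on with
  | C a => simp [dehomogenize, MvPolynomial.algebraMap_eq]
  | add p q hp hq => simp [hp, hq]
  | mul_X p i hp =>
    rw [map_mul, map_mul, hp, map_mul]
    congr 1
    refine Fin.cases ?_ (fun j => ?_) i <;> simp [dehomogenize]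

variable {F : Type*} [Field F] {m : ℕ} {w : Fin (m + 1) → ℕ} {d : ℕ}
  {f : MvPolynomial (Fin (m + 1)) F}

theorem totalDegree_dehomogenize_le (hf : f.IsWeightedHomogeneous w d) {c : ℕ} (hc : 0 < c)
    (hw : ∀ i, i ≠ 0 → c ≤ w i) : (dehomogenize f).totalDegree ≤ d / c := by
  rw [dehomogenize, aeval_def, eval₂_eq]
  refine totalDegree_finsetSum_le fun a ha => ?_
  rw [Nat.le_div_iff_mul_le hc, MvPolynomial.algebraMap_eq]
  have h1 := hf (mem_support_iff.mp ha)
  rw [Finsupp.weight_apply, Finsupp.sum] at h1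
  rw [← h1]
  refine le_trans (Nat.mul_le_mul_right c ((totalDegree_mul _ _).trans (add_le_add
    (totalDegree_C _).le (totalDegree_finsetProd _ _)))) ?_
  rw [zero_add, Finset.sum_mul]
  refine Finset.sum_le_sum fun i _ => ?_
  refine le_trans (Nat.mul_le_mul_right c (totalDegree_pow _ _)) ?_
  rw [mul_assoc, smul_eq_mul]
  refine Nat.mul_le_mul_left _ ?_
  rcases Fin.eq_zero_or_eq_succ i with rfl | ⟨j, rfl⟩
  · simp
  · simpa using hw _ (Fin.succ_ne_zero j)

/-- In the field of rational functions, `f` is `X_0 ^ d` times the value of its dehomogenization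
at the elements `X_i / X_0 ^ w_i`. -/
theorem dehomogenize_ne_zero (hf : f.IsWeightedHomogeneous w d) (hw0 : w 0 = 1) (h0 : f ≠ 0) :
    dehomogenize f ≠ 0 := by
  intro h
  apply h0
  let A := MvPolynomial (Fin (m + 1)) F
  let K := FractionRing A
  let x : Fin (m + 1) → K := fun i => algebraMap A K (X i)
  have hx0 : x 0 ≠ 0 := by
    have := (IsFractionRing.injective A K).ne (X_ne_zero (R := F) (0 : Fin (m + 1)))
    rwa [map_zero] at this
  let y : Fin m → K := fun i => x i.succ / x 0 ^ w i.succ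
  have h1 : x = fun i => x 0 ^ w i * (Fin.cons 1 y : Fin (m + 1) → K) i := by
    funext i
    rcases Fin.eq_zero_or_eq_succ i with rfl | ⟨j, rfl⟩
    · simp [hw0]
    · simp only [Fin.cons_succ, y]
      rw [mul_div_cancel₀ _ (pow_ne_zero _ hx0)]
  have h2 : aeval (Fin.cons 1 y : Fin (m + 1) → K) f = aeval y (dehomogenize f) := by
    have : (aeval (Fin.cons 1 y : Fin (m + 1) → K) : A →ₐ[F] K) =
        (aeval y).comp dehomogenize := by
      ext i
      rcases Fin.eq_zero_or_eq_succ i with rfl | ⟨j, rfl⟩ <;> simp [dehomogenize]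
    rw [this]; rfl
  have h3 : algebraMap A K f = aeval x f := by
    have : (IsScalarTower.toAlgHom F A K) = aeval x := by
      ext i
      rw [aeval_X, IsScalarTower.coe_toAlgHom']
    rw [← this]; rfl
  apply IsFractionRing.injective A K
  rw [h3, h1, aeval_smul hf, h2, h, map_zero, mul_zero, map_zero]

/-- Schwartz–Zippel for weighted homogeneous polynomials, on the affine chart `x_0 = 1`. -/
theorem card_chart_eval_ne_zero [Fintype F] [DecidableEq F] (hf : f.IsWeightedHomogeneous w d)
    (hw0 : w 0 = 1) (h0 : f ≠ 0) {c : ℕ} (hc : 0 < c) (hw : ∀ i, i ≠ 0 → c ≤ w i) :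
    (Fintype.card F - d / c) * Fintype.card F ^ m ≤ Fintype.card F *
      ((Finset.univ.filter fun x : Fin (m + 1) → F => x 0 = 1).filter
        fun x => eval x f ≠ 0).card := by
  refine (card_eval_ne_zero_of_totalDegree_le (dehomogenize_ne_zero hf hw0 h0)
    (totalDegree_dehomogenize_le hf hc hw)).trans (Nat.mul_le_mul_left _ ?_)
  refine Finset.card_le_card_of_injOn (fun x => (Fin.cons 1 x : Fin (m + 1) → F)) ?_
    ((Fin.cons_right_injective (α := fun _ => F) 1).injOn)
  intro x hx
  simpa [eval_dehomogenize] using hx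

end Dehomogenization

/-! ### The weighted form of Serre's inequality -/

section UpperBound

variable {F : Type*} [Field F] {m : ℕ}

/-- Over the locus `x_0 ≠ 0` the nonvanishing set of `f` is swept out by the orbits of its points
in the chart `x_0 = 1`. -/
theorem card_eval_ne_zero_eq [Fintype F] [DecidableEq F] {w : Fin (m + 1) → ℕ} {d : ℕ}
    {f : MvPolynomial (Fin (m + 1)) F} (hf : f.IsWeightedHomogeneous w d) (hw0 : w 0 = 1) :
    (Finset.univ.filter fun x : Fin (m + 1) → F => eval x f ≠ 0).card =
      (Fintype.card F - 1) * ((Finset.univ.filter fun x : Fin (m + 1) → F => x 0 = 1).filter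
        fun x => eval x f ≠ 0).card +
      ((Finset.univ.filter fun x : Fin (m + 1) → F => x 0 = 0).filter
        fun x => eval x f ≠ 0).card := by
  rw [← Finset.card_filter_add_card_filter_not (p := fun x : Fin (m + 1) → F => x 0 = 0), add_comm]
  congr 1
  · symm
    have hq : Fintype.card F - 1 = (Finset.univ.erase (0 : F)).card := by
      rw [Finset.card_erase_of_mem (Finset.mem_univ _), Finset.card_univ]
    rw [hq, ← Finset.card_product]
    refine Finset.card_bij (fun p _ i => p.1 ^ w i * p.2 i) ?_ ?_ ?_
    · rintro ⟨c, x⟩ h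
      simp only [Finset.mem_product, Finset.mem_erase, Finset.mem_univ, and_true,
        Finset.mem_filter, true_and] at h ⊢
      refine ⟨?_, ?_⟩
      · rw [eval_weighted_smul hf]
        exact mul_ne_zero (pow_ne_zero _ h.1) h.2.2
      · rw [h.2.1, hw0, pow_one, mul_one]
        exact h.1
    · rintro ⟨c, x⟩ h ⟨c', x'⟩ h' heq
      simp only [Finset.mem_product, Finset.mem_erase, Finset.mem_univ, and_true,
        Finset.mem_filter, true_and] at h h' heq
      have h1 := congrFun heq 0
      simp only [h.2.1, h'.2.1, hw0, pow_one, mul_one] at h1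
      subst h1
      rw [Prod.mk.injEq]
      exact ⟨rfl, funext fun i => mul_left_cancel₀ (pow_ne_zero _ h.1) (congrFun heq i)⟩
    · intro y hy
      simp only [Finset.mem_filter, Finset.mem_univ, true_and] at hy
      have hy' : (fun i => y 0 ^ w i * (y i / y 0 ^ w i)) = y :=
        funext fun i => mul_div_cancel₀ _ (pow_ne_zero _ hy.2)
      refine ⟨⟨y 0, fun i => y i / y 0 ^ w i⟩, ?_, hy'⟩
      simp only [Finset.mem_product, Finset.mem_erase, Finset.mem_univ, and_true,
        Finset.mem_filter, true_and]
      refine ⟨hy.2, ?_, fun h => hy.1 ?_⟩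
      · rw [hw0, pow_one, div_self hy.2]
      · rw [← hy', eval_weighted_smul hf, h, mul_zero]
  · rw [Finset.filter_comm]

/-- The polynomial `g` with `f = g (X_0 ^ c, X_1, …, X_m)`, for `f` in which all exponents of
`X_0` are multiples of `c`. (In general the exponents of `X_0` are divided by `c` and rounded
down.) -/
noncomputable def contractFirst {R : Type*} [CommRing R] (c : ℕ)
    (f : MvPolynomial (Fin (m + 1)) R) : MvPolynomial (Fin (m + 1)) R :=
  ∑ a ∈ f.support, monomial (a.update 0 (a 0 / c)) (coeff a f)

theorem aeval_contractFirst {c : ℕ} {f : MvPolynomial (Fin (m + 1)) F}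
    (hc : ∀ a ∈ f.support, c ∣ a 0) {A : Type*} [CommRing A] [Algebra F A]
    {y z : Fin (m + 1) → A} (h0 : y 0 ^ c = z 0) (h : ∀ i, y (Fin.succ i) = z (Fin.succ i)) :
    aeval z (contractFirst c f) = aeval y f := by
  rw [contractFirst, map_sum, aeval_def (f := y), eval₂_eq]
  refine Finset.sum_congr rfl fun a ha => ?_
  rw [aeval_monomial, Finsupp.prod_fintype _ _ (fun _ => pow_zero _)]
  congr 1
  have h1 : ∏ i ∈ a.support, y i ^ a i = ∏ i, y i ^ a i :=
    Finset.prod_subset (Finset.subset_univ _) fun i _ hi => by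
      rw [Finsupp.notMem_support_iff.mp hi, pow_zero]
  rw [h1, Fin.prod_univ_succ, Fin.prod_univ_succ]
  congr 1
  · rw [Finsupp.coe_update, Function.update_self, ← h0, ← pow_mul, Nat.mul_div_cancel' (hc a ha)]
  · refine Finset.prod_congr rfl fun i _ => ?_
    rw [Finsupp.coe_update, Function.update_of_ne (Fin.succ_ne_zero i), h]

theorem contractFirst_ne_zero {c : ℕ} {f : MvPolynomial (Fin (m + 1)) F}
    (hc : ∀ a ∈ f.support, c ∣ a 0) (h0 : f ≠ 0) : contractFirst c f ≠ 0 := by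
  intro h
  have h1 := aeval_contractFirst hc (A := MvPolynomial (Fin (m + 1)) F) (y := X)
    (z := Fin.cons (X 0 ^ c) fun i => X i.succ) rfl (fun _ => rfl)
  rw [h, map_zero, aeval_X_left_apply] at h1
  exact h0 h1.symm

/-- The weighted form of Serre's inequality, for weights `1` at `0` and at least `c`
elsewhere: `⌈d / c⌉ = (d - 1) / c + 1` takes the place of the degree. -/
theorem le_card_eval_ne_zero [Fintype F] [DecidableEq F] {w : Fin (m + 1) → ℕ} {d c : ℕ}
    (hd : 1 ≤ d) (hc : 0 < c) (hw0 : w 0 = 1) (hw : ∀ i, i ≠ 0 → c ≤ w i)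
    {f : MvPolynomial (Fin (m + 1)) F} (hf : f.IsWeightedHomogeneous w d) (h0 : f ≠ 0) :
    (Fintype.card F - 1) * (Fintype.card F - (d - 1) / c) * Fintype.card F ^ (m + 1) ≤
      Fintype.card F ^ 2 *
        (Finset.univ.filter fun x : Fin (m + 1) → F => eval x f ≠ 0).card := by
  set q := Fintype.card F with hq
  set k := (d - 1) / c with hk
  set N₁ := ((Finset.univ.filter fun x : Fin (m + 1) → F => x 0 = 1).filter
        fun x => eval x f ≠ 0).card with hN
  -- It is enough to have sufficiently many points in the chart `x_0 = 1`.
  have hchart : (q - k) * q ^ m ≤ q * N₁ →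
      (q - 1) * (q - k) * q ^ (m + 1) ≤ q ^ 2 *
        (Finset.univ.filter fun x : Fin (m + 1) → F => eval x f ≠ 0).card := by
    intro h
    rw [card_eval_ne_zero_eq hf hw0, ← hq, ← hN]
    calc (q - 1) * (q - k) * q ^ (m + 1) = q * (q - 1) * ((q - k) * q ^ m) := by ring
      _ ≤ q * (q - 1) * (q * N₁) := Nat.mul_le_mul_left _ h
      _ = q ^ 2 * ((q - 1) * N₁) := by ring
      _ ≤ _ := Nat.mul_le_mul_left _ (Nat.le_add_right _ _)
  by_cases hcd : c ∣ d
  swap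
  · have hk' : d / c = k := by
      rw [hk]
      obtain ⟨d, rfl⟩ := Nat.exists_eq_add_of_le' hd
      rw [Nat.add_sub_cancel, Nat.succ_div_of_not_dvd hcd]
    refine hchart ?_
    rw [← hk']
    exact card_chart_eval_ne_zero hf hw0 h0 hc hw
  obtain ⟨e, rfl⟩ := hcd
  have he : 1 ≤ e := Nat.pos_of_ne_zero (by rintro rfl; simp at hd)
  have hk' : k = e - 1 := by
    obtain ⟨e, rfl⟩ := Nat.exists_eq_add_of_le' he
    have h1 : c * (e + 1) = e * c + c := by ring
    have h2 : (e + 1) * c = e * c + c := by ring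
    rw [hk, Nat.add_sub_cancel]
    exact Nat.div_eq_of_lt_le (by omega) (by omega)
  by_cases hvar : ∃ i ∈ f.vars, i ≠ 0 ∧ c < w i
  · -- Restrict to the lines in the direction of a variable of weight greater than `c`.
    obtain ⟨i, hi, hi0, hci⟩ := hvar
    refine hchart ?_
    have hv : ∀ j, (Pi.single i 1 : Fin (m + 1) → F) j ≠ 0 → w j = w i := by
      intro j hj
      by_contra hne
      exact hj (Pi.single_eq_of_ne (fun h => hne (by rw [h])) _)
    have ha : (alongLine (Pi.single i (1 : F)) f).natDegree ≠ 0 :=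
      fun h => notMem_vars_of_natDegree_alongLine_eq_zero h hi
    have h1 := card_eval_ne_zero_alongLine (Pi.single i (1 : F)) f
      (Finset.univ.filter fun x : Fin (m + 1) → F => x 0 = 1) (by
        intro x hx t
        simpa [Pi.single_eq_of_ne' hi0] using hx)
    have h2 := card_chart_eval_ne_zero (isWeightedHomogeneous_leadingCoeff_alongLine hv hf) hw0
      (Polynomial.leadingCoeff_ne_zero.mpr (alongLine_ne_zero _ h0)) hc hw
    have h3 := natDegree_alongLine_mul_le hv hf h0
    set a := (alongLine (Pi.single i (1 : F)) f).natDegree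
    rw [← hq] at h1 h2
    rw [← hN] at h1
    have h4 : a + (c * e - a * w i) / c ≤ k := by
      have h5 : a * (c + 1) ≤ a * w i := Nat.mul_le_mul_left _ hci
      have h6 : a < e := by
        by_contra hle
        have : c * e ≤ c * a := Nat.mul_le_mul_left _ (not_lt.mp hle)
        nlinarith [Nat.pos_of_ne_zero ha]
      have h7 : (c * e - a * w i) / c < e - a := by
        rw [Nat.div_lt_iff_lt_mul hc, Nat.sub_mul, mul_comm e c]
        have := Nat.pos_of_ne_zero ha
        have h8 : a * (c + 1) = a * c + a := by ring
        omega
      omega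
    have hqpos : 0 < q := Fintype.card_pos
    refine Nat.le_of_mul_le_mul_left ?_ hqpos
    calc q * ((q - k) * q ^ m) = q * (q - k) * q ^ m := (mul_assoc _ _ _).symm
      _ ≤ (q - a) * (q - (c * e - a * w i) / c) * q ^ m :=
        Nat.mul_le_mul_right _ (sub_mul_sub_le h4)
      _ = (q - a) * ((q - (c * e - a * w i) / c) * q ^ m) := mul_assoc _ _ _
      _ ≤ (q - a) * (q * _) := Nat.mul_le_mul_left _ h2
      _ = q * ((q - a) * _) := by ring
      _ ≤ q * (q * N₁) := Nat.mul_le_mul_left _ h1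
  · -- Now `f` is a form of degree `e` in `X_0 ^ c` and the variables of weight `c`.
    push Not at hvar
    have hdeg : ∀ a ∈ f.support, a 0 + c * ∑ i : Fin m, a i.succ = c * e := by
      intro a ha
      rw [← hf (mem_support_iff.mp ha), Finsupp.weight_apply,
        Finsupp.sum_fintype _ _ (by simp), Fin.sum_univ_succ, hw0, smul_eq_mul,
        mul_one, Finset.mul_sum]
      congr 1
      refine Finset.sum_congr rfl fun i _ => ?_
      rw [smul_eq_mul, mul_comm]
      rcases eq_or_ne (a i.succ) 0 with hz | hz
      · rw [hz, zero_mul, zero_mul]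
      · rw [le_antisymm (hw _ (Fin.succ_ne_zero i)) (hvar _ ((mem_vars_iff_mem_support _).mpr
          ⟨a, ha, Finsupp.mem_support_iff.mpr hz⟩) (Fin.succ_ne_zero i))]
    have hdvd : ∀ a ∈ f.support, c ∣ a 0 := fun a ha =>
      (Nat.dvd_add_left (Dvd.intro _ rfl)).mp (Dvd.intro _ (hdeg a ha).symm)
    have hg : (contractFirst c f).IsHomogeneous e := by
      refine IsHomogeneous.sum _ _ _ fun a ha => isHomogeneous_monomial _ ?_
      rw [Finsupp.degree_eq_sum, Fin.sum_univ_succ, Finsupp.coe_update, Function.update_self]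
      simp only [Function.update_of_ne (Fin.succ_ne_zero _)]
      obtain ⟨r, hr⟩ := hdvd a ha
      have h1 := hdeg a ha
      rw [hr, Nat.mul_div_cancel_left _ hc]
      rw [hr, ← mul_add] at h1
      exact Nat.eq_of_mul_eq_mul_left hc h1
    have heval : ∀ x : Fin (m + 1) → F, x 0 ^ c = x 0 →
        eval x (contractFirst c f) = eval x f := fun x hx =>
      aeval_contractFirst hdvd hx (fun _ => rfl)
    -- The two polynomials agree where `x_0` is `0` or `1`.
    have hcard : (Finset.univ.filter fun x : Fin (m + 1) → F => eval x f ≠ 0).card =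
        (Finset.univ.filter fun x : Fin (m + 1) → F => eval x (contractFirst c f) ≠ 0).card := by
      rw [card_eval_ne_zero_eq hf hw0, card_eval_ne_zero_eq hg rfl]
      congr 2
      · refine congrArg _ (Finset.filter_congr fun x hx => ?_)
        have hx : x 0 = 1 := (Finset.mem_filter.mp hx).2
        rw [heval x (by rw [hx, one_pow])]
      · refine Finset.filter_congr fun x hx => ?_
        have hx : x 0 = 0 := (Finset.mem_filter.mp hx).2
        rw [heval x (by rw [hx, zero_pow hc.ne'])]
    rw [hcard, show q - k = q + 1 - e by omega]
    exact serre_inequality he hg (contractFirst_ne_zero hdvd h0)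

end UpperBound

/-! ### Counting rational points by coordinate vectors -/

section RationalPoints

variable {F : Type*} [Field F] {σ : Type*}

theorem mem_range_algebraMap_of_pow_card_eq [Finite F] {K : Type*} [Field K] [Algebra F K] {y : K}
    (hy : y ^ Nat.card F = y) : y ∈ Set.range (algebraMap F K) := by
  classical
  cases nonempty_fintype F
  rw [Nat.card_eq_fintype_card] at hy
  have hq : 1 < Fintype.card F := Fintype.one_lt_card
  have hne := FiniteField.X_pow_card_sub_X_ne_zero K hq
  -- The images of the elements of `F` already account for all roots of `X ^ q - X`.
  have hsub : Finset.univ.image (algebraMap F K) ⊆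
      (Polynomial.X ^ Fintype.card F - Polynomial.X : Polynomial K).roots.toFinset := by
    intro z hz
    obtain ⟨a, -, rfl⟩ := Finset.mem_image.mp hz
    rw [Multiset.mem_toFinset, Polynomial.mem_roots hne]
    simp [← map_pow, FiniteField.pow_card]
  have heq := Finset.eq_of_subset_of_card_le hsub (by
    rw [Finset.card_image_of_injective _ (algebraMap F K).injective, Finset.card_univ]
    refine (Multiset.toFinset_card_le _).trans ((Polynomial.card_roots' _).trans ?_)
    rw [FiniteField.X_pow_card_sub_X_natDegree_eq K hq])
  have hmem : y ∈ (Polynomial.X ^ Fintype.card F - Polynomial.X : Polynomial K).roots.toFinset := by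
    rw [Multiset.mem_toFinset, Polynomial.mem_roots hne]
    simp [hy]
  rw [← heq] at hmem
  obtain ⟨a, -, ha⟩ := Finset.mem_image.mp hmem
  exact ⟨a, ha⟩

/-- The point of `ℙ(w)` over an extension `K` with a given coordinate vector over `F`. -/
def ofVec (K : Type*) [Field K] [Algebra F K] (w : σ → ℕ) (x : {x : σ → F // x ≠ 0}) :
    Points K w :=
  mk w ⟨fun i => algebraMap F K (x.1 i), fun h => x.2 (funext fun i =>
    (algebraMap F K).injective ((congrFun h i).trans (map_zero _).symm))⟩

theorem ofVec_eq_ofVec_iff {K : Type*} [Field K] [Algebra F K] {w : σ → ℕ}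
    {x y : {x : σ → F // x ≠ 0}} :
    ofVec K w x = ofVec K w y ↔
      ∃ c : Kˣ, ∀ i, algebraMap F K (y.1 i) = (c : K) ^ w i * algebraMap F K (x.1 i) :=
  Quotient.eq (r := setoid K w)

/-- Every rational point has coordinates in `F`: if the Frobenius multiplies a coordinate vector
by `c⁻¹`, rescale it by a `(q - 1)`-st root of `c`. -/
theorem mem_rationalPoints_iff [Finite F] {w : σ → ℕ} {P : Points (AlgebraicClosure F) w} :
    P ∈ rationalPoints F w ↔ ∃ x : {x : σ → F // x ≠ 0}, ofVec (AlgebraicClosure F) w x = P := by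
  have hq : 1 < Nat.card F := Finite.one_lt_card
  constructor
  · induction P using Quotient.ind with | _ x
    intro h
    obtain ⟨c, hc⟩ := Quotient.exact (s := setoid _ w) h
    obtain ⟨b, hb⟩ := IsAlgClosed.exists_pow_nat_eq (c : AlgebraicClosure F)
      (show 0 < Nat.card F - 1 by omega)
    have hb0 : b ≠ 0 := by
      rintro rfl
      rw [zero_pow (by omega)] at hb
      exact c.ne_zero hb.symm
    have hbq : b ^ Nat.card F = c * b := by
      rw [← hb, ← pow_succ, Nat.sub_add_cancel hq.le]
    have hmem : ∀ i, ∃ a : F, algebraMap F (AlgebraicClosure F) a = b ^ w i * x.1 i := by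
      intro i
      refine mem_range_algebraMap_of_pow_card_eq ?_
      have h1 : x.1 i = (c : AlgebraicClosure F) ^ w i * x.1 i ^ Nat.card F := hc i
      rw [mul_pow, pow_right_comm, hbq, mul_pow]
      conv_rhs => rw [h1]
      ring
    choose a ha using hmem
    have hx0 : (fun i => a i) ≠ 0 := by
      obtain ⟨i, hi⟩ := Function.ne_iff.mp x.2
      refine Function.ne_iff.mpr ⟨i, fun h => ?_⟩
      have h2 := ha i
      simp only [Pi.zero_apply] at h
      rw [h, map_zero] at h2
      exact mul_ne_zero (pow_ne_zero _ hb0) hi h2.symm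
    refine ⟨⟨a, hx0⟩, Quotient.sound (s := setoid _ w) ⟨(Units.mk0 b hb0)⁻¹, fun i => ?_⟩⟩
    simp only [ha, Units.val_inv_eq_inv_val, Units.val_mk0]
    rw [← mul_assoc, ← mul_pow, inv_mul_cancel₀ hb0, one_pow, one_mul]
  · rintro ⟨x, rfl⟩
    refine congrArg (mk w) (Subtype.ext (funext fun i => ?_))
    cases nonempty_fintype F
    simp only [powVec, ← map_pow]
    rw [Nat.card_eq_fintype_card, FiniteField.pow_card]

/-- Each rational point has exactly `q - 1` coordinate vectors over `F`. If `g` is the greatest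
common divisor of the weights of the nonzero coordinates of `x`, they are the vectors
`(u ^ (w_i / g) x_i)_i` with `u ∈ Fˣ`, since every `u` is a `g`-th power in `K`. -/
theorem card_fiber_ofVec [Finite F] {K : Type*} [Field K] [IsAlgClosed K] [Algebra F K]
    {w : σ → ℕ} (hw : ∀ i, 0 < w i) (x : {x : σ → F // x ≠ 0}) :
    Nat.card {y : {x : σ → F // x ≠ 0} // ofVec K w y = ofVec K w x} = Nat.card F - 1 := by
  classical
  let H : AddSubgroup ℤ := AddSubgroup.closure {n | ∃ i, x.1 i ≠ 0 ∧ n = w i}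
  obtain ⟨g₀, hg₀⟩ := Int.subgroup_cyclic H
  obtain ⟨g, hg⟩ : ∃ g : ℕ, H = AddSubgroup.zmultiples (g : ℤ) :=
    ⟨g₀.natAbs, by rw [Int.zmultiples_natAbs, hg₀, AddSubgroup.zmultiples_eq_closure]⟩
  have hwH : ∀ i, x.1 i ≠ 0 → (w i : ℤ) ∈ H := fun i hi =>
    AddSubgroup.subset_closure ⟨i, hi, rfl⟩
  have hdvd : ∀ i, x.1 i ≠ 0 → g ∣ w i := fun i hi => by
    have := hwH i hi
    rw [hg, Int.mem_zmultiples_iff] at this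
    exact_mod_cast this
  obtain ⟨i₀, hi₀⟩ := Function.ne_iff.mp x.2
  have hgpos : 0 < g := Nat.pos_of_dvd_of_pos (hdvd i₀ hi₀) (hw i₀)
  -- A subgroup of `Kˣ` that contains all `c ^ w_i` contains `c ^ g`.
  have hbez : ∀ (S : Subgroup Kˣ) (c : Kˣ), (∀ i, x.1 i ≠ 0 → c ^ w i ∈ S) → c ^ g ∈ S := by
    intro S c h
    have hle : H ≤ (Subgroup.toAddSubgroup S).comap (zmultiplesHom (Additive Kˣ)
        (Additive.ofMul c)) := by
      rw [AddSubgroup.closure_le]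
      rintro n ⟨i, hi, rfl⟩
      have := h i hi
      change c ^ (w i : ℤ) ∈ S
      rwa [zpow_natCast]
    have h1 : (g : ℤ) ∈ H := hg ▸ AddSubgroup.mem_zmultiples _
    have h2 : c ^ (g : ℤ) ∈ S := hle h1
    rwa [zpow_natCast] at h2
  have hroot : ∀ u : Fˣ, ∃ c : Kˣ, (c : K) ^ g = algebraMap F K u := by
    intro u
    obtain ⟨c, hc⟩ := IsAlgClosed.exists_pow_nat_eq (algebraMap F K u) hgpos
    have hc0 : c ≠ 0 := by
      rintro rfl
      rw [zero_pow hgpos.ne'] at hc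
      exact (u.map (algebraMap F K).toMonoidHom).ne_zero hc.symm
    exact ⟨Units.mk0 c hc0, hc⟩
  have hsmul : ∀ (u : Fˣ) (c : Kˣ), (c : K) ^ g = algebraMap F K u → ∀ i,
      algebraMap F K ((u : F) ^ (w i / g) * x.1 i) = (c : K) ^ w i * algebraMap F K (x.1 i) := by
    intro u c hc i
    rcases eq_or_ne (x.1 i) 0 with hi | hi
    · simp [hi]
    · rw [map_mul, map_pow, ← hc, ← pow_mul, Nat.mul_div_cancel' (hdvd i hi)]
  let φ : Fˣ → {y : {x : σ → F // x ≠ 0} // ofVec K w y = ofVec K w x} := fun u =>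
    ⟨⟨fun i => (u : F) ^ (w i / g) * x.1 i, Function.ne_iff.mpr
      ⟨i₀, mul_ne_zero (pow_ne_zero _ u.ne_zero) hi₀⟩⟩, by
      obtain ⟨c, hc⟩ := hroot u
      exact (ofVec_eq_ofVec_iff.mpr ⟨c, hsmul u c hc⟩).symm⟩
  have hφ : Function.Bijective φ := by
    constructor
    · intro u u' h
      have h1 : ∀ i, x.1 i ≠ 0 → (u / u') ^ (w i / g) = 1 := by
        intro i hi
        have h2 : (u : F) ^ (w i / g) * x.1 i = (u' : F) ^ (w i / g) * x.1 i :=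
          congrFun (congrArg (fun z => z.1.1) h) i
        rw [div_pow, div_eq_one]
        exact Units.ext (by exact_mod_cast mul_right_cancel₀ hi h2)
      obtain ⟨c, hc⟩ := hroot (u / u')
      have h3 := hbez ⊥ c fun i hi => by
        rw [Subgroup.mem_bot]
        apply Units.ext
        rw [Units.val_pow_eq_pow_val, ← Nat.mul_div_cancel' (hdvd i hi), pow_mul, hc, ← map_pow,
          ← Units.val_pow_eq_pow_val, h1 i hi]
        simp
      rw [Subgroup.mem_bot] at h3
      rw [← Units.val_pow_eq_pow_val, h3, Units.val_one] at hc
      rw [← div_eq_one]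
      apply Units.ext
      apply (algebraMap F K).injective
      rw [← hc, Units.val_one, map_one]
    · rintro ⟨y, hy⟩
      obtain ⟨c, hc⟩ := ofVec_eq_ofVec_iff.mp hy.symm
      obtain ⟨u, hu⟩ := hbez (Units.map (algebraMap F K).toMonoidHom).range c fun i hi => by
        have hyi : y.1 i ≠ 0 := by
          intro h0
          have := hc i
          rw [h0, map_zero] at this
          exact mul_ne_zero (pow_ne_zero _ c.ne_zero)
            ((map_ne_zero (algebraMap F K)).mpr hi) this.symm
        refine ⟨Units.mk0 (y.1 i) hyi / Units.mk0 (x.1 i) hi, ?_⟩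
        apply Units.ext
        simp only [Units.coe_map, Units.val_div_eq_div_val, Units.val_mk0,
          Units.val_pow_eq_pow_val]
        change algebraMap F K (y.1 i / x.1 i) = _
        rw [map_div₀, hc i, mul_div_cancel_right₀]
        exact (map_ne_zero (algebraMap F K)).mpr hi
      have hu' : (c : K) ^ g = algebraMap F K u := by
        rw [← Units.val_pow_eq_pow_val, ← hu]
        rfl
      refine ⟨u, Subtype.ext (Subtype.ext (funext fun i => (algebraMap F K).injective ?_))⟩
      rw [hc i]
      exact hsmul u c hu' i
  rw [← Nat.card_congr (Equiv.ofBijective φ hφ), Nat.card_units]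

/-- The zeros of `f` on `ℙ(w)(F)` and the vectors over `F` at which `f` does not vanish: the
remaining vectors are `0` and `q - 1` vectors for each zero. -/
theorem exists_encard_rationalZeros [Fintype F] [DecidableEq F] [Fintype σ] [DecidableEq σ]
    {w : σ → ℕ} (hw : ∀ i, 0 < w i)
    {d : ℕ} (hd : 1 ≤ d) {f : MvPolynomial σ F} (hf : f.IsWeightedHomogeneous w d) :
    ∃ N : ℕ, (rationalZeros w f).encard = N ∧
      N * (Fintype.card F - 1) + (Finset.univ.filter fun x : σ → F => eval x f ≠ 0).card + 1 =
        Fintype.card F ^ Fintype.card σ := by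
  classical
  let K := AlgebraicClosure F
  let Z : Finset {x : σ → F // x ≠ 0} := Finset.univ.filter fun x => eval x.1 f = 0
  have hvan : ∀ x, Vanishes f (ofVec K w x) ↔ eval x.1 f = 0 := by
    intro x
    rw [ofVec, vanishes_mk_iff hf]
    change aeval (fun i => algebraMap F K (x.1 i)) f = 0 ↔ _
    have := aeval_algebraMap_apply (R := F) K x.1 f
    change aeval (fun i => algebraMap F K (x.1 i)) f = _ at this
    rw [this, map_eq_zero]
    rfl
  have hset : rationalZeros w f = ((Z.image (ofVec K w) : Finset _) : Set (Points K w)) := by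
    ext P
    simp only [rationalZeros, Set.mem_ofPred_eq, Finset.coe_image, Set.mem_image, Finset.mem_coe]
    constructor
    · rintro ⟨hP, hV⟩
      obtain ⟨x, rfl⟩ := mem_rationalPoints_iff.mp hP
      exact ⟨x, Finset.mem_filter.mpr ⟨Finset.mem_univ _, (hvan x).mp hV⟩, rfl⟩
    · rintro ⟨x, hx, rfl⟩
      exact ⟨mem_rationalPoints_iff.mpr ⟨x, rfl⟩, (hvan x).mpr (Finset.mem_filter.mp hx).2⟩
  refine ⟨(Z.image (ofVec K w)).card, by rw [hset, Set.encard_coe_eq_coe_finsetCard], ?_⟩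
  have hfib : Z.card = (Z.image (ofVec K w)).card * (Fintype.card F - 1) := by
    rw [Finset.card_eq_sum_card_image (ofVec K w) Z, ← smul_eq_mul, ← Finset.sum_const]
    refine Finset.sum_congr rfl fun P hP => ?_
    obtain ⟨x, hx, rfl⟩ := Finset.mem_image.mp hP
    rw [← Nat.card_eq_fintype_card, ← card_fiber_ofVec (K := K) hw x, Nat.card_eq_fintype_card,
      Fintype.card_subtype]
    congr 1
    ext y
    simp only [Finset.mem_filter, Z, Finset.mem_univ, true_and, and_iff_right_iff_imp]
    intro h
    rw [← hvan, h, hvan]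
    exact (Finset.mem_filter.mp hx).2
  have h0 : eval (0 : σ → F) f = 0 := by
    rw [eval_zero, constantCoeff_eq]
    exact hf.coeff_eq_zero 0 (by rw [map_zero]; omega)
  have hZ : (Finset.univ.filter fun x : σ → F => eval x f = 0).card = Z.card + 1 := by
    rw [← Finset.card_erase_add_one (a := (0 : σ → F)) 
      (Finset.mem_filter.mpr ⟨Finset.mem_univ _, h0⟩)]
    congr 1
    rw [← Finset.card_map (Function.Embedding.subtype _)]
    congr 1
    ext x
    simp [Z, and_comm]
  have h3 := Finset.card_filter_add_card_filter_not (s := (Finset.univ : Finset (σ → F)))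
    (fun x => eval x f = 0)
  rw [Finset.card_univ, Fintype.card_fun] at h3
  rw [← hfib, ← h3, hZ]
  simp only [ne_eq]
  omega

end RationalPoints

/-! ### The maximum -/

section Maximum

theorem sub_one_mul_p {q : ℕ} (hq : 2 ≤ q) (n : ℕ) {k : ℤ} (hk : k + 1 = n) :
    (q - 1) * p q k + 1 = q ^ n := by
  have h1 : q - 1 ∣ q ^ n - 1 := by simpa using Nat.sub_dvd_pow_sub_pow q 1 n
  rw [p, hk, Int.toNat_natCast, Nat.mul_div_cancel' h1,
    Nat.sub_add_cancel (Nat.one_le_pow _ _ (by omega))]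

/-- The bound of the theorem, in terms of the number of vectors where the polynomial does not
vanish. The truncated difference `q - k` accounts for the minimum. -/
theorem min_p_mul_add {q : ℕ} (hq : 2 ≤ q) (m k : ℕ) :
    min (p q ((m + 1 : ℕ) : ℤ)) ((k + 1) * q ^ m + p q (((m + 1 : ℕ) : ℤ) - 2)) * (q - 1) +
      (q - 1) * (q - k) * q ^ m + 1 = q ^ (m + 2) := by
  have h1 := sub_one_mul_p hq (m + 2) (k := ((m + 1 : ℕ) : ℤ)) (by push_cast; ring)
  have h2 := sub_one_mul_p hq m (k := ((m + 1 : ℕ) : ℤ) - 2) (by push_cast; ring)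
  set P := p q ((m + 1 : ℕ) : ℤ)
  set P₂ := p q (((m + 1 : ℕ) : ℤ) - 2)
  obtain ⟨r, rfl⟩ := Nat.exists_eq_add_of_le' (show 1 ≤ q by omega)
  rw [Nat.add_sub_cancel] at h1 h2 ⊢
  have hr : 0 < r := by omega
  rw [pow_add, ← h2] at h1 ⊢
  set Q := r * P₂ + 1
  rcases le_total k (r + 1) with hk | hk
  · obtain ⟨s, hs⟩ := Nat.exists_eq_add_of_le hk
    have h3 : r * ((k + 1) * Q + P₂) + r * s * Q + 1 = Q * (r + 1) ^ 2 := by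
      have : k + s = r + 1 := hs.symm
      have h4 : r * ((k + 1) * Q + P₂) + r * s * Q + 1 = r * (k + s + 1) * Q + Q := by
        simp only [Q]; ring
      rw [h4, this]
      ring
    rw [min_eq_right, show r + 1 - k = s by omega, mul_comm _ r, h3]
    refine Nat.le_of_mul_le_mul_left ?_ hr
    omega
  · rw [min_eq_left, show r + 1 - k = 0 by omega, mul_zero, zero_mul, add_zero, mul_comm, h1]
    refine Nat.le_of_mul_le_mul_left ?_ hr
    have h3 : r * ((r + 1 + 1) * Q + P₂) + 1 = Q * (r + 1) ^ 2 := by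
      have h4 : r * ((r + 1 + 1) * Q + P₂) + 1 = r * (r + 1 + 1) * Q + Q := by
        simp only [Q]; ring
      rw [h4]
      ring
    have h5 : r * ((r + 1 + 1) * Q + P₂) ≤ r * ((k + 1) * Q + P₂) := by gcongr
    omega

variable {F : Type*} [Field F] {m : ℕ} {w : Fin (m + 2) → ℕ}

/-- The polynomial `X_0 ^ r ∏_{a ∈ A} (X_1 - a X_0 ^ c)`. -/
noncomputable def hyperplaneProduct (m : ℕ) (r c : ℕ) (A : Finset F) :
    MvPolynomial (Fin (m + 2)) F :=
  X 0 ^ r * ∏ a ∈ A, (X (Fin.succ 0) - C a * X 0 ^ c)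

theorem eval_hyperplaneProduct (r c : ℕ) (A : Finset F) (x : Fin (m + 2) → F) :
    eval x (hyperplaneProduct m r c A) =
      x 0 ^ r * ∏ a ∈ A, (x (Fin.succ 0) - a * x 0 ^ c) := by
  simp [hyperplaneProduct, map_prod]

theorem hyperplaneProduct_ne_zero (r : ℕ) {c : ℕ} (hc : 0 < c) (A : Finset F) :
    hyperplaneProduct m r c A ≠ 0 := by
  refine mul_ne_zero (pow_ne_zero _ (X_ne_zero _)) (Finset.prod_ne_zero_iff.mpr fun a _ h => ?_)
  have := congrArg (eval (Fin.cons 0 fun _ => 1 : Fin (m + 2) → F)) h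
  simp [-Fin.succ_zero_eq_one, hc.ne'] at this

theorem isWeightedHomogeneous_hyperplaneProduct (hw0 : w 0 = 1) (r : ℕ) (A : Finset F) :
    (hyperplaneProduct m r (w (Fin.succ 0)) A).IsWeightedHomogeneous w
      (r + A.card * w (Fin.succ 0)) := by
  refine IsWeightedHomogeneous.mul ?_ ?_
  · simpa [hw0] using (isWeightedHomogeneous_X F w 0).pow r
  · rw [← smul_eq_mul, ← Finset.sum_const]
    refine IsWeightedHomogeneous.prod _ _ _ fun a _ => ?_
    refine (isWeightedHomogeneous_X F w _).sub (IsWeightedHomogeneous.C_mul ?_ a)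
    simpa [hw0] using (isWeightedHomogeneous_X F w 0).pow (w (Fin.succ 0))

theorem card_eval_hyperplaneProduct_ne_zero [Fintype F] [DecidableEq F] (hw0 : w 0 = 1) {r : ℕ}
    (hr : 0 < r) (A : Finset F) :
    (Finset.univ.filter fun x : Fin (m + 2) → F =>
        eval x (hyperplaneProduct m r (w (Fin.succ 0)) A) ≠ 0).card =
      (Fintype.card F - 1) * (Fintype.card F - A.card) * Fintype.card F ^ m := by
  rw [card_eval_ne_zero_eq (isWeightedHomogeneous_hyperplaneProduct hw0 r A) hw0]
  have h0 : ((Finset.univ.filter fun x : Fin (m + 2) → F => x 0 = 0).filter fun x =>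
      eval x (hyperplaneProduct m r (w (Fin.succ 0)) A) ≠ 0) = ∅ := by
    refine Finset.filter_eq_empty_iff.mpr fun x hx => ?_
    rw [not_not, eval_hyperplaneProduct, (Finset.mem_filter.mp hx).2, zero_pow hr.ne', zero_mul]
  have h1 : ((Finset.univ.filter fun x : Fin (m + 2) → F => x 0 = 1).filter fun x =>
      eval x (hyperplaneProduct m r (w (Fin.succ 0)) A) ≠ 0) =
      Fintype.piFinset (Fin.cons {1} (Fin.cons Aᶜ fun _ => Finset.univ) :
        Fin (m + 2) → Finset F) := by
    ext x
    simp only [Finset.mem_filter, Finset.mem_univ, true_and, Fintype.mem_piFinset,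
      Fin.forall_fin_succ, Fin.cons_zero, Fin.cons_succ, Finset.mem_singleton,
      Finset.mem_compl, eval_hyperplaneProduct, implies_true, and_true]
    refine and_congr_right fun hx => ?_
    rw [hx, one_pow, one_mul, Finset.prod_ne_zero_iff]
    simp only [one_pow, mul_one, ne_eq, sub_eq_zero]
    exact ⟨fun h hA => h _ hA rfl, fun h a ha hxa => h (hxa ▸ ha)⟩
  rw [h0, h1, Fintype.card_piFinset, Fin.prod_univ_succ, Fin.prod_univ_succ]
  simp [-Fin.succ_zero_eq_one, Finset.card_compl, mul_assoc]

end Maximum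
end WPS

theorem theorem1p1 (F : Type*) [Field F] [Finite F] (q : ℕ) (hq : Nat.card F = q)
    (m : ℕ) (hm : 1 ≤ m) (w : Fin (m + 1) → ℕ) (hw0 : w 0 = 1) (hw : Monotone w)
    (d : ℕ) (hd : 1 ≤ d) :
    IsGreatest (WPS.zeroCounts F w d)
      ((min (WPS.p q m)
        (((d - 1) / w ⟨1, Nat.lt_succ_of_le hm⟩ + 1) * q ^ (m - 1) + WPS.p q ((m : ℤ) - 2)) : ℕ) :
          ℕ∞) := by
  classical
  cases nonempty_fintype F
  rw [Nat.card_eq_fintype_card] at hq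
  have hq2 : 2 ≤ q := hq ▸ Fintype.one_lt_card
  obtain ⟨m, rfl⟩ := Nat.exists_eq_add_of_le' hm
  have hidx : (⟨1, Nat.lt_succ_of_le hm⟩ : Fin (m + 2)) = Fin.succ 0 := by
    apply Fin.ext
    simp
  rw [hidx, Nat.add_sub_cancel]
  set c := w (Fin.succ 0) with hc
  set k := (d - 1) / c with hk
  have hwpos : ∀ i, 0 < w i := fun i => by
    have := hw (Fin.zero_le i)
    omega
  have hwc : ∀ i, i ≠ 0 → c ≤ w i := fun i hi => by
    obtain ⟨j, rfl⟩ := Fin.exists_succ_eq.mpr hi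
    exact hw (Fin.succ_le_succ_iff.mpr (Fin.zero_le j))
  have hbound := WPS.min_p_mul_add hq2 m k
  rw [show q ^ (m + 2) = q ^ (m + 1 + 1) from rfl] at hbound
  set M := min (WPS.p q ((m + 1 : ℕ) : ℤ))
    ((k + 1) * q ^ m + WPS.p q (((m + 1 : ℕ) : ℤ) - 2))
  have hpos : 0 < q - 1 := by omega
  constructor
  · -- `min k q` values of `X_1 / X_0 ^ c`; at least one factor `X_0` is left, as `c * k < d`.
    obtain ⟨A, -, hA⟩ := Finset.exists_subset_card_eq
      (s := (Finset.univ : Finset F)) (n := min k q)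
      (by rw [Finset.card_univ, hq]; exact min_le_right _ _)
    have hAc : A.card * c ≤ d - 1 := by
      rw [hA]
      exact (Nat.mul_le_mul_right _ (min_le_left _ _)).trans (Nat.div_mul_le_self _ _)
    have hhom := WPS.isWeightedHomogeneous_hyperplaneProduct hw0 (d - A.card * c) A
    rw [← hc, Nat.sub_add_cancel (by omega)] at hhom
    have hcard := WPS.card_eval_hyperplaneProduct_ne_zero hw0
      (show 0 < d - A.card * c by omega) A
    obtain ⟨N, hN, hcount⟩ := WPS.exists_encard_rationalZeros hwpos hd hhom
    rw [← hc] at hcard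
    rw [hcard, hq, Fintype.card_fin, hA,
      show q - min k q = q - k by omega] at hcount
    refine ⟨_, WPS.hyperplaneProduct_ne_zero _ (hwpos _) A, hhom, ?_⟩
    rw [hN]
    have : N = M := Nat.eq_of_mul_eq_mul_right hpos (by omega)
    rw [this]
  · rintro _ ⟨f, hf0, hf, rfl⟩
    obtain ⟨N, hN, hcount⟩ := WPS.exists_encard_rationalZeros hwpos hd hf
    have hle := WPS.le_card_eval_ne_zero hd (hwpos _) hw0 hwc hf hf0
    rw [hN]
    rw [hq, Fintype.card_fin] at hcount
    rw [hq, ← hk, show (q - 1) * (q - k) * q ^ (m + 1 + 1) =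
      q ^ 2 * ((q - 1) * (q - k) * q ^ m) by ring] at hle
    have hle' := Nat.le_of_mul_le_mul_left hle (by positivity)
    have : N ≤ M := Nat.le_of_mul_le_mul_right (c := q - 1) (by omega) hpos
    exact_mod_cast this
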